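/- For an integer $N\ge 2$ and $f:\mathbb{Z}_N\to\mathbb{C}$ let $\hat f(k)=\sum_{t\in\mathbb{Z}_N} f(t)e^{-2\pi i kt/N}$ and $\|f\|_{\ell_1}=\sum_{t\in\mathbb{Z}_N}|f(t)|$. For $0<\tau<1$ let $(I_k)_{k\in\mathbb{Z}_N}$ be independent random variables with $\mathbf{P}(I_k=1)=\tau$ and $\mathbf{P}(I_k=0)=1-\tau$, and let $\Omega=\{k\in\mathbb{Z}_N: I_k=1\}$ be the resulting random set of frequencies. For a signal $f$ consider the problem $$(P_1)\qquad \min_{g\in\mathbb{C}^N}\|g\|_{\ell_1}\quad\text{subject to}\quad \hat g(k)=\hat f(k)\ \text{ for all } k\in\Omega .$$ **Theorem.** Let $M>0$ and $\delta>0$, and put $$\alpha(M)=\frac{1-\delta}{29.6\,(M+1)} .$$ There is a constant $C>0$, depending only on $M$ and $\delta$, such that for all $N\ge 2$, all $0<\tau<1$, all $T\subset\mathbb{Z}_N$ and all $f:\mathbb{Z}_N\to\mathbb{C}$ supported on $T$ the following holds. If $$|T|\le \alpha(M)\,(\log N)^{-1}\,\tau N,$$ then with probability at least $1-CN^{-M}$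 the minimizer of $(P_1)$ is unique and is equal to $f$. -/

import Mathlib

open MeasureTheory ProbabilityTheory

universe u

/-- The `ℓ¹` norm `∑ t, |g t|` of a signal `g ∈ ℂ^N`, indexed by `ℤ/Nℤ`. -/
noncomputable def l1Norm {N : ℕ} [NeZero N] (g : ZMod N → ℂ) : ℝ :=
  ∑ t, ‖g t‖

/-- The feasible signals of the problem `(P₁)`: those whose discrete Fourier transform
`ĝ k = ∑ t, g t * exp (-2 π i k t / N)` agrees with that of `f` on the frequency set `Om`. -/
def feasibleSet {N : ℕ} [NeZero N] (Om : Set (ZMod N)) (f : ZMod N → ℂ) : Set (ZMod N → ℂ) :=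
  {g | ∀ k ∈ Om, ZMod.dft g k = ZMod.dft f k}

/-- The minimizers of `(P₁)`: minimize `‖g‖_{ℓ¹}` subject to `ĝ = f̂` on `Om`. -/
def l1Minimizers {N : ℕ} [NeZero N] (Om : Set (ZMod N)) (f : ZMod N → ℂ) : Set (ZMod N → ℂ) :=
  {g | g ∈ feasibleSet Om f ∧ ∀ h ∈ feasibleSet Om f, l1Norm g ≤ l1Norm h}

/-- `I k`, `k ∈ ℤ/Nℤ`, are independent Bernoulli random variables under `P`, each equal to `1` with
probability `τ` and to `0` with probability `1 - τ`. -/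
structure IsBernoulliFamily {N : ℕ} {S : Type u} [MeasurableSpace S] (P : Measure S) (τ : ℝ)
    (I : ZMod N → S → ℕ) : Prop where
  measurable : ∀ k, Measurable (I k)
  indep : iIndepFun I P
  prob_one : ∀ k, P.real {s | I k s = 1} = τ
  prob_zero : ∀ k, P.real {s | I k s = 0} = 1 - τ

/-- The random set of observed frequencies `{k : I k = 1}`. -/
def randomFreq {N : ℕ} {S : Type u} (I : ZMod N → S → ℕ) (s : S) : Set (ZMod N) :=
  {k | I k s = 1}

/-!
The signal `f` is the unique minimizer once there is an approximate dual certificate: a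
trigonometric polynomial with frequencies in `Ω` that is close to `sgn f` on `T` and bounded by
`99 / 100` off `T`
(`l1Minimizers_eq_singleton`). The certificate is built by a randomized Kaczmarz iteration.

The random set `Ω` has the law of the set of values of independent uniform draws `k₁, k₂, …` from
`ℤ/Nℤ`, their number being Poisson distributed with mean `lam = -N log (1 - τ) ≥ τ N`
(`hasSum_drawAvg_toFinset`). Start from the residual `r = sgn f` and, at each draw `k`, replace
`r t` by `r t - (η / |T|) e(t k) z` for all `t`, where `z` is the `k`-th Fourier coefficient of
the restriction of `r` to `T`. The difference between the initial and the current residual is a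
polynomial with frequencies in `Ω`, so the residual has to become small on `T` and stay below
`99 / 100` off `T`. Let `x` be the root mean square of `r` over `T`. The relaxation parameter is
`η = min 1 (c / x)`, with `c` of order `1 / ((M + 1) log N)`. There are two supermartingales.

* On `T`: the function `cosh (a x) - 1` is convex in `x ^ 2`, so its average after a step is largest
  if the step is either void or, with probability `1 / |T|`, in the direction of the residual. In
  the latter case `x` becomes `max (x - c) 0`, which at least halves the function if `a c ≥ 7 / 10`
  (`avg_cosh_rmsOn_le`). It therefore decays like `(1 - 1 / (2 |T|)) ^ m`.
* Off `T`: the value `r t` is a martingale with increments at most `c`. The square of each increment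
  is at most `2 c` times the decrease of `x` in the same step, so that
  `exp (lam * Re (ω r t) + 2 c lam² x)` is a supermartingale (`avg_exp_re_add_rmsOn_le`). Its
  initial value is at most `exp (2 c lam²)`, because `x ≤ 1` initially.

The same iteration with `η = 1`, started at the unit vectors of `T`, makes these small on `T`; this
gives the quantitative injectivity that absorbs the remaining residual on `T`
(`sqrt_energyOn_le_of_dft_eq_zero`). With `L = (M + 1) log N` the mean number of draws is at least
`29.6 L |T|`, and the failure probabilities of the three requirements, averaged over the
number of draws, are at most a constant times `N ^ (-M)`.
-/

/-! ### The relaxed Kaczmarz iteration -/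

section Kaczmarz

open ZMod (stdAddChar)

variable {N : ℕ}

/-- The squared `ℓ²` norm of the restriction of `r` to `T`. -/
noncomputable def energyOn (T : Finset (ZMod N)) (r : ZMod N → ℂ) : ℝ :=
  ∑ j ∈ T, ‖r j‖ ^ 2

lemma energyOn_nonneg (T : Finset (ZMod N)) (r : ZMod N → ℂ) : 0 ≤ energyOn T r :=
  Finset.sum_nonneg fun _ _ => by positivity

variable [NeZero N]

/-- The `k`-th Fourier coefficient of the restriction of `r` to `T`. -/
noncomputable def coeffOn (T : Finset (ZMod N)) (r : ZMod N → ℂ) (k : ZMod N) : ℂ :=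
  ∑ j ∈ T, stdAddChar (-(j * k)) * r j

/-- One relaxed Kaczmarz step with relaxation parameter `η` at the frequency `k`. On `T` it moves
`r` towards the hyperplane where the coefficient `coeffOn T r k` vanishes (`η = 1` is the orthogonal
projection); off `T` it subtracts the same multiple of the character of frequency `k`. -/
noncomputable def kaczmarzStep (T : Finset (ZMod N)) (η : ℝ) (k : ZMod N) (r : ZMod N → ℂ) :
    ZMod N → ℂ :=
  fun t => r t - (η / T.card : ℝ) * (stdAddChar (t * k) * coeffOn T r k)

/-- The Kaczmarz iteration along a list of frequencies, the relaxation parameter `φ r` of each step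
being a function of the current residual `r`. -/
noncomputable def kaczmarzRun (T : Finset (ZMod N)) (φ : (ZMod N → ℂ) → ℝ) :
    List (ZMod N) → (ZMod N → ℂ) → (ZMod N → ℂ)
  | [], r => r
  | k :: l, r => kaczmarzRun T φ l (kaczmarzStep T (φ r) k r)

lemma conj_stdAddChar (a : ZMod N) :
    (starRingEnd ℂ) (stdAddChar a) = stdAddChar (-a) := by
  rw [AddChar.map_neg_eq_conj]

lemma norm_stdAddChar (a : ZMod N) : ‖(stdAddChar a : ℂ)‖ = 1 := AddChar.norm_apply _ _

lemma norm_coeffOn_sq_le (T : Finset (ZMod N)) (r : ZMod N → ℂ) (k : ZMod N) :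
    ‖coeffOn T r k‖ ^ 2 ≤ T.card * energyOn T r := by
  have h1 : ‖coeffOn T r k‖ ≤ ∑ j ∈ T, ‖r j‖ := by
    refine (norm_sum_le _ _).trans_eq ?_
    simp
  calc ‖coeffOn T r k‖ ^ 2 ≤ (∑ j ∈ T, ‖r j‖) ^ 2 := by gcongr
    _ ≤ _ := sq_sum_le_card_mul_sum_sq

lemma coeffOn_eq_dft (T : Finset (ZMod N)) (r : ZMod N → ℂ) :
    coeffOn T r = ZMod.dft (fun j => if j ∈ T then r j else 0) := by
  ext k
  simp [coeffOn, ZMod.dft_apply, Finset.sum_ite_mem]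

/-- Fourier inversion for the restriction of `r` to `T`. -/
lemma sum_stdAddChar_mul_coeffOn (T : Finset (ZMod N)) (r : ZMod N → ℂ) (t : ZMod N) :
    ∑ k, stdAddChar (t * k) * coeffOn T r k = N * (if t ∈ T then r t else 0) := by
  have h := congrFun (ZMod.dft.symm_apply_apply (fun j => if j ∈ T then r j else 0)) t
  rw [← coeffOn_eq_dft, ZMod.invDFT_apply] at h
  rw [← h]
  have hN : (N : ℂ) ≠ 0 := NeZero.ne _
  simp [mul_comm t, hN]

/-- Parseval's identity for the restriction of `r` to `T`. -/
lemma sum_norm_coeffOn_sq (T : Finset (ZMod N)) (r : ZMod N → ℂ) :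
    ∑ k, ‖coeffOn T r k‖ ^ 2 = N * energyOn T r := by
  have key : ∑ k, coeffOn T r k * (starRingEnd ℂ) (coeffOn T r k)
      = N * ∑ j ∈ T, r j * (starRingEnd ℂ) (r j) := by
    calc ∑ k, coeffOn T r k * (starRingEnd ℂ) (coeffOn T r k)
        = ∑ k, ∑ j ∈ T, (starRingEnd ℂ) (r j) * (stdAddChar (j * k) * coeffOn T r k) := by
          refine Finset.sum_congr rfl fun k _ => ?_
          conv_lhs => rw [mul_comm]; enter [1]; rw [coeffOn]
          rw [map_sum, Finset.sum_mul]
          refine Finset.sum_congr rfl fun j _ => ?_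
          rw [map_mul, conj_stdAddChar, neg_neg]; ring
      _ = ∑ j ∈ T, (starRingEnd ℂ) (r j) * (N * r j) := by
          rw [Finset.sum_comm]
          refine Finset.sum_congr rfl fun j hj => ?_
          rw [← Finset.mul_sum, sum_stdAddChar_mul_coeffOn, if_pos hj]
      _ = _ := by rw [Finset.mul_sum]; exact Finset.sum_congr rfl fun j _ => by ring
  simp only [Complex.mul_conj, Complex.normSq_eq_norm_sq] at key
  unfold energyOn
  exact_mod_cast key

lemma energyOn_kaczmarzStep {T : Finset (ZMod N)} (hT : T.Nonempty) (η : ℝ) (k : ZMod N)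
    (r : ZMod N → ℂ) :
    energyOn T (kaczmarzStep T η k r)
      = energyOn T r - (2 * η - η ^ 2) * ‖coeffOn T r k‖ ^ 2 / T.card := by
  have hs : (T.card : ℝ) ≠ 0 := by exact_mod_cast hT.card_pos.ne'
  set z := coeffOn T r k with hz
  have hcross : ∑ j ∈ T, (r j * (starRingEnd ℂ) (stdAddChar (j * k) * z)).re = ‖z‖ ^ 2 := by
    have : ∑ j ∈ T, r j * (starRingEnd ℂ) (stdAddChar (j * k) * z) = z * (starRingEnd ℂ) z := by
      conv_rhs => enter [1]; rw [hz, coeffOn]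
      rw [Finset.sum_mul]
      refine Finset.sum_congr rfl fun j _ => ?_
      rw [map_mul, conj_stdAddChar]; ring
    rw [← Complex.re_sum, this, Complex.mul_conj, Complex.normSq_eq_norm_sq, Complex.ofReal_re]
  have hterm : ∀ j, ‖kaczmarzStep T η k r j‖ ^ 2 = ‖r j‖ ^ 2
      - 2 * (η / T.card) * (r j * (starRingEnd ℂ) (stdAddChar (j * k) * z)).re
      + (η / T.card) ^ 2 * ‖z‖ ^ 2 := by
    intro j
    have h1 : ‖stdAddChar (j * k) * z‖ = ‖z‖ := by rw [norm_mul, norm_stdAddChar, one_mul]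
    rw [kaczmarzStep, ← hz, ← h1]
    generalize stdAddChar (j * k) * z = v
    generalize η / (T.card : ℝ) = a
    rw [← Complex.normSq_eq_norm_sq, ← Complex.normSq_eq_norm_sq, ← Complex.normSq_eq_norm_sq]
    simp [Complex.normSq_apply]; ring
  unfold energyOn
  simp only [hterm, Finset.sum_add_distrib, Finset.sum_sub_distrib, ← Finset.mul_sum, hcross,
    Finset.sum_const, nsmul_eq_mul]
  field_simp
  ring

lemma energyOn_kaczmarzStep_le {T : Finset (ZMod N)} (hT : T.Nonempty) {η : ℝ} (h0 : 0 ≤ η)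
    (h1 : η ≤ 1) (k : ZMod N) (r : ZMod N → ℂ) :
    energyOn T (kaczmarzStep T η k r) ≤ energyOn T r := by
  rw [energyOn_kaczmarzStep hT]
  have : 0 ≤ (2 * η - η ^ 2) * ‖coeffOn T r k‖ ^ 2 / T.card := by
    have : 0 ≤ 2 * η - η ^ 2 := by nlinarith
    positivity
  linarith

/-- The iteration only adds characters with frequencies in `l`, so pairing with a signal whose
Fourier transform vanishes on `l` does not see it. -/
lemma sum_mul_conj_kaczmarzRun (T : Finset (ZMod N)) (φ : (ZMod N → ℂ) → ℝ) (h : ZMod N → ℂ)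
    (l : List (ZMod N)) (hh : ∀ k ∈ l, ZMod.dft h k = 0) (r : ZMod N → ℂ) :
    ∑ j, h j * (starRingEnd ℂ) (kaczmarzRun T φ l r j) = ∑ j, h j * (starRingEnd ℂ) (r j) := by
  induction l generalizing r with
  | nil => rfl
  | cons k l ih =>
    rw [kaczmarzRun, ih fun k' hk' => hh k' (List.mem_cons_of_mem _ hk')]
    have hk := hh k List.mem_cons_self
    rw [ZMod.dft_apply] at hk
    have : ∀ j, h j * (starRingEnd ℂ) (kaczmarzStep T (φ r) k r j) = h j * (starRingEnd ℂ) (r j)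
        - (starRingEnd ℂ) (((φ r / T.card : ℝ) : ℂ) * coeffOn T r k) *
          (stdAddChar (-(j * k)) • h j) := by
      intro j
      rw [← conj_stdAddChar, kaczmarzStep]
      simp only [map_sub, map_mul, smul_eq_mul]; ring
    simp only [this, Finset.sum_sub_distrib, ← Finset.mul_sum, hk, mul_zero, sub_zero]

/-- Each step changes every value by at most `‖r‖_{ℓ²(T)} / √|T|`. -/
lemma norm_kaczmarzRun_le {T : Finset (ZMod N)} (hT : T.Nonempty)
    {φ : (ZMod N → ℂ) → ℝ} (h0 : ∀ r, 0 ≤ φ r) (h1 : ∀ r, φ r ≤ 1) (l : List (ZMod N))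
    (r : ZMod N → ℂ) (t : ZMod N) (hr : energyOn T r ≤ 1) :
    ‖kaczmarzRun T φ l r t‖ ≤ ‖r t‖ + l.length / √T.card := by
  have hs : (0 : ℝ) < T.card := by exact_mod_cast hT.card_pos
  induction l generalizing r with
  | nil => simp [kaczmarzRun]
  | cons k l ih =>
    have hstep := energyOn_kaczmarzStep_le hT (h0 r) (h1 r) k r
    refine (ih _ (hstep.trans hr)).trans ?_
    have hz : ‖coeffOn T r k‖ ≤ √T.card := by
      apply Real.le_sqrt_of_sq_le
      exact (norm_coeffOn_sq_le T r k).trans (mul_le_of_le_one_right hs.le hr)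
    have h2 : ‖kaczmarzStep T (φ r) k r t‖ ≤ ‖r t‖ + 1 / √T.card := by
      rw [kaczmarzStep]
      refine (norm_sub_le _ _).trans ?_
      rw [norm_mul, norm_mul, norm_stdAddChar, one_mul, Complex.norm_real, Real.norm_eq_abs,
        abs_of_nonneg (div_nonneg (h0 r) hs.le)]
      have : φ r / T.card * ‖coeffOn T r k‖ ≤ 1 / T.card * √T.card := by
        gcongr; exact h1 r
      have h3 : 1 / (T.card : ℝ) * √T.card = 1 / √T.card := by
        rw [one_div_mul_eq_div, Real.sqrt_div_self']
      linarith
    rw [List.length_cons, Nat.cast_add, Nat.cast_one, add_div]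
    linarith

end Kaczmarz

/-! ### Averages over uniform draws -/

section Draws

variable {N : ℕ} [NeZero N]

/-- The average of `G` over all lists of `m` frequencies, that is, its expectation over `m`
independent uniform draws from `ℤ/Nℤ`. -/
noncomputable def drawAvg : ℕ → (List (ZMod N) → ℝ) → ℝ
  | 0, G => G []
  | m + 1, G => (N : ℝ)⁻¹ * ∑ k, drawAvg m fun l => G (k :: l)

lemma drawAvg_mono {m : ℕ} {G H : List (ZMod N) → ℝ} (h : ∀ l, l.length = m → G l ≤ H l) :
    drawAvg m G ≤ drawAvg m H := by
  induction m generalizing G H with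
  | zero => exact h [] rfl
  | succ m ih =>
    unfold drawAvg
    gcongr with k _
    exact ih fun l hl => h _ (by simp [hl])

lemma drawAvg_add (m : ℕ) (G H : List (ZMod N) → ℝ) :
    drawAvg m (fun l => G l + H l) = drawAvg m G + drawAvg m H := by
  induction m generalizing G H with
  | zero => rfl
  | succ m ih => simp only [drawAvg, ih, Finset.sum_add_distrib, mul_add]

lemma drawAvg_const_mul (m : ℕ) (c : ℝ) (G : List (ZMod N) → ℝ) :
    drawAvg m (fun l => c * G l) = c * drawAvg m G := by
  induction m generalizing G with
  | zero => rfl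
  | succ m ih => simp only [drawAvg, ih, ← Finset.mul_sum]; ring

lemma drawAvg_sum {ι : Type*} (m : ℕ) (s : Finset ι) (G : ι → List (ZMod N) → ℝ) :
    drawAvg m (fun l => ∑ i ∈ s, G i l) = ∑ i ∈ s, drawAvg m (G i) := by
  classical
  induction s using Finset.induction_on with
  | empty =>
    have := drawAvg_const_mul (N := N) m 0 fun _ => 0
    simpa using this
  | insert a s ha ih => simp only [Finset.sum_insert ha, drawAvg_add, ih]

/-- The probability that `m` uniform draws all lie in `B`. -/
lemma drawAvg_toFinset_subset (m : ℕ) (B : Finset (ZMod N)) :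
    drawAvg m (fun l => if l.toFinset ⊆ B then 1 else 0) = ((B.card : ℝ) / N) ^ m := by
  induction m with
  | zero => simp [drawAvg]
  | succ m ih =>
    have hk : ∀ k : ZMod N, drawAvg m (fun l => if (k :: l).toFinset ⊆ B then (1 : ℝ) else 0)
        = (if k ∈ B then 1 else 0) * ((B.card : ℝ) / N) ^ m := by
      intro k
      rw [← ih, ← drawAvg_const_mul]
      congr 1
      ext l
      by_cases h : k ∈ B <;> simp [List.toFinset_cons, Finset.insert_subset_iff, h]
    simp only [drawAvg, hk, ← Finset.sum_mul]
    simp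
    ring

/-- A function of the residual that one step multiplies by at most `ρ` on average is multiplied by
at most `ρ ^ m` on average over `m` steps. -/
lemma drawAvg_kaczmarzRun_le (T : Finset (ZMod N)) (φ : (ZMod N → ℂ) → ℝ)
    (Φ : (ZMod N → ℂ) → ℝ) {ρ : ℝ} (hρ : 0 ≤ ρ)
    (hstep : ∀ r, (N : ℝ)⁻¹ * ∑ k, Φ (kaczmarzStep T (φ r) k r) ≤ ρ * Φ r) (m : ℕ)
    (r : ZMod N → ℂ) :
    drawAvg m (fun l => Φ (kaczmarzRun T φ l r)) ≤ ρ ^ m * Φ r := by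
  induction m generalizing r with
  | zero => simp [drawAvg, kaczmarzRun]
  | succ m ih =>
    calc drawAvg (m + 1) (fun l => Φ (kaczmarzRun T φ l r))
        ≤ (N : ℝ)⁻¹ * ∑ k, ρ ^ m * Φ (kaczmarzStep T (φ r) k r) := by
          unfold drawAvg
          gcongr with k _
          exact ih _
      _ = ρ ^ m * ((N : ℝ)⁻¹ * ∑ k, Φ (kaczmarzStep T (φ r) k r)) := by
          rw [← Finset.mul_sum]; ring
      _ ≤ ρ ^ m * (ρ * Φ r) := mul_le_mul_of_nonneg_left (hstep r) (by positivity)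
      _ = ρ ^ (m + 1) * Φ r := by ring

/-- With full Kaczmarz projections the energy decays by the factor `1 - 1 / |T|` per draw. -/
lemma drawAvg_energyOn_le {T : Finset (ZMod N)} (hT : T.Nonempty) (m : ℕ) (r : ZMod N → ℂ) :
    drawAvg m (fun l => energyOn T (kaczmarzRun T (fun _ => 1) l r))
      ≤ (1 - 1 / (T.card : ℝ)) ^ m * energyOn T r := by
  have hs : (1 : ℝ) ≤ T.card := by exact_mod_cast hT.card_pos
  have hN : (N : ℝ) ≠ 0 := NeZero.ne _
  refine drawAvg_kaczmarzRun_le T _ (energyOn T) ?_ (fun r => le_of_eq ?_) m r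
  · rw [sub_nonneg, div_le_one (by linarith)]; exact hs
  · simp only [energyOn_kaczmarzStep hT, Finset.sum_sub_distrib, ← Finset.sum_div, ← Finset.mul_sum,
      sum_norm_coeffOn_sq]
    simp
    field_simp
    ring

end Draws

/-! ### Two supermartingales for the adaptive iteration -/

section Supermartingales

variable {N : ℕ}

/-- The root mean square of `r` over `T`. -/
noncomputable def rmsOn (T : Finset (ZMod N)) (r : ZMod N → ℂ) : ℝ :=
  √(energyOn T r / T.card)

/-- The adaptive relaxation parameter: it keeps every step off `T` below `c`, and a step in the
direction of the residual decreases the root mean square of the residual by exactly `c` as long as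
it exceeds `c`. -/
noncomputable def adaptiveRelax (T : Finset (ZMod N)) (c : ℝ) (r : ZMod N → ℂ) : ℝ :=
  min 1 (c / rmsOn T r)

lemma rmsOn_nonneg (T : Finset (ZMod N)) (r : ZMod N → ℂ) : 0 ≤ rmsOn T r := Real.sqrt_nonneg _

lemma rmsOn_sq (T : Finset (ZMod N)) (r : ZMod N → ℂ) :
    rmsOn T r ^ 2 = energyOn T r / T.card :=
  Real.sq_sqrt (div_nonneg (energyOn_nonneg _ _) (Nat.cast_nonneg _))

lemma adaptiveRelax_nonneg (T : Finset (ZMod N)) {c : ℝ} (hc : 0 ≤ c) (r : ZMod N → ℂ) :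
    0 ≤ adaptiveRelax T c r :=
  le_min zero_le_one (div_nonneg hc (rmsOn_nonneg _ _))

lemma adaptiveRelax_le_one (T : Finset (ZMod N)) (c : ℝ) (r : ZMod N → ℂ) :
    adaptiveRelax T c r ≤ 1 := min_le_left _ _

lemma adaptiveRelax_mul_rmsOn_le (T : Finset (ZMod N)) {c : ℝ} (hc : 0 ≤ c) (r : ZMod N → ℂ) :
    adaptiveRelax T c r * rmsOn T r ≤ c := by
  rcases (rmsOn_nonneg T r).eq_or_lt with h | h
  · rw [← h, mul_zero]; exact hc
  · calc _ ≤ c / rmsOn T r * rmsOn T r := by gcongr; exact min_le_right _ _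
      _ = c := by field_simp

lemma one_sub_adaptiveRelax_mul_rmsOn (T : Finset (ZMod N)) {c : ℝ} (hc : 0 ≤ c)
    (r : ZMod N → ℂ) :
    (1 - adaptiveRelax T c r) * rmsOn T r = max (rmsOn T r - c) 0 := by
  unfold adaptiveRelax
  rcases (rmsOn_nonneg T r).eq_or_lt with h | h
  · rw [← h]; simp [hc]
  · rcases le_total 1 (c / rmsOn T r) with h1 | h1
    · rw [min_eq_left h1, max_eq_right]; · ring
      rw [le_div_iff₀ h] at h1; linarith
    · rw [min_eq_right h1, max_eq_left]; · field_simp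
      rw [div_le_iff₀ h] at h1; linarith

variable [NeZero N]

lemma rmsOn_kaczmarzStep_sq {T : Finset (ZMod N)} (hT : T.Nonempty) (η : ℝ) (k : ZMod N)
    (r : ZMod N → ℂ) :
    rmsOn T (kaczmarzStep T η k r) ^ 2
      = rmsOn T r ^ 2 - (2 * η - η ^ 2) * (‖coeffOn T r k‖ / T.card) ^ 2 := by
  rw [rmsOn_sq, rmsOn_sq, energyOn_kaczmarzStep hT]
  field_simp

lemma norm_coeffOn_div_le {T : Finset (ZMod N)} (hT : T.Nonempty) (r : ZMod N → ℂ) (k : ZMod N) :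
    ‖coeffOn T r k‖ / T.card ≤ rmsOn T r := by
  have hs : (0 : ℝ) < T.card := by exact_mod_cast hT.card_pos
  apply Real.le_sqrt_of_sq_le
  rw [div_pow, div_le_div_iff₀ (by positivity) hs]
  have := norm_coeffOn_sq_le T r k
  nlinarith

lemma avg_norm_coeffOn_div_sq {T : Finset (ZMod N)} (hT : T.Nonempty) (r : ZMod N → ℂ) :
    (N : ℝ)⁻¹ * ∑ k, (‖coeffOn T r k‖ / T.card) ^ 2 = rmsOn T r ^ 2 / T.card := by
  have hN : (N : ℝ) ≠ 0 := NeZero.ne _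
  simp only [div_pow, ← Finset.sum_div, sum_norm_coeffOn_sq, rmsOn_sq]
  field_simp

/-- Convexity of `y ↦ cosh (√y)`, which holds because its power series has nonnegative
coefficients. -/
lemma cosh_le_of_sq_eq {x v w ξ : ℝ} (h0 : 0 ≤ ξ) (h1 : ξ ≤ 1)
    (h : w ^ 2 = (1 - ξ) * x ^ 2 + ξ * v ^ 2) :
    Real.cosh w ≤ (1 - ξ) * Real.cosh x + ξ * Real.cosh v := by
  refine hasSum_le (fun n => ?_) (Real.hasSum_cosh w)
    (((Real.hasSum_cosh x).mul_left (1 - ξ)).add ((Real.hasSum_cosh v).mul_left ξ))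
  have := (convexOn_pow (𝕜 := ℝ) n).2 (x := x ^ 2) (by simp; positivity) (y := v ^ 2)
    (by simp; positivity) (sub_nonneg.2 h1) h0 (by ring)
  have hn := (Nat.cast_pos (α := ℝ)).2 (2 * n).factorial_pos
  simp only [smul_eq_mul, ← h] at this
  simp only [pow_mul, ← mul_div_assoc, ← add_div]
  gcongr

lemma cosh_max_sub_le {u h : ℝ} (hh : 7 / 10 ≤ h) :
    Real.cosh (max (u - h) 0) - 1 ≤ (Real.cosh u - 1) / 2 := by
  rcases le_total (u - h) 0 with h0 | h0
  · rw [max_eq_right h0, Real.cosh_zero]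
    linarith [Real.one_le_cosh u]
  · rw [max_eq_left h0, Real.cosh_eq, Real.cosh_eq]
    have hq : 2 ≤ Real.exp h := by
      rw [← Real.log_le_iff_le_exp (by norm_num)]
      linarith [Real.log_two_lt_d9]
    have hpq : Real.exp h ≤ Real.exp u := Real.exp_le_exp.2 (by linarith)
    rw [Real.exp_sub, neg_sub, Real.exp_sub, Real.exp_neg]
    generalize Real.exp h = q at *
    generalize Real.exp u = p at *
    have hp : 0 < p := by linarith
    have e1 : (p / q + q / p) / 2 - 1 = (p - q) ^ 2 / (2 * (p * q)) := by field_simp; ring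
    have e2 : ((p + p⁻¹) / 2 - 1) / 2 = (p - 1) ^ 2 / (2 * (p * 2)) := by field_simp; ring
    rw [e1, e2]
    gcongr
    linarith

/-- The `cosh` of the residual shrinks on average. By convexity the worst case is the one where the
step is either in the direction of the residual, with probability `1 / |T|`, or void. -/
lemma avg_cosh_rmsOn_le {T : Finset (ZMod N)} (hT : T.Nonempty) {c a : ℝ} (hc : 0 < c)
    (ha : 0 ≤ a) (hac : 7 / 10 ≤ a * c) (r : ZMod N → ℂ) :
    (N : ℝ)⁻¹ * ∑ k, (Real.cosh (a * rmsOn T (kaczmarzStep T (adaptiveRelax T c r) k r)) - 1)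
      ≤ (1 - 1 / (2 * T.card)) * (Real.cosh (a * rmsOn T r) - 1) := by
  have hs : (0 : ℝ) < T.card := by exact_mod_cast hT.card_pos
  have hN : (N : ℝ) ≠ 0 := NeZero.ne _
  set η := adaptiveRelax T c r with hη
  set x := rmsOn T r with hx
  have hx0 : 0 ≤ x := rmsOn_nonneg T r
  set D := Real.cosh (a * x) - 1 with hD
  -- `ξ k` is the squared cosine of the angle between the residual and the direction of the step.
  set ξ : ZMod N → ℝ := fun k => (‖coeffOn T r k‖ / T.card) ^ 2 / x ^ 2 with hξ
  have hD0 : 0 ≤ D := by linarith [Real.one_le_cosh (a * x)]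
  have hk : ∀ k, Real.cosh (a * rmsOn T (kaczmarzStep T η k r)) - 1 ≤ D - D / 2 * ξ k := by
    intro k
    have hζ := norm_coeffOn_div_le hT r k
    have hζ0 : 0 ≤ ‖coeffOn T r k‖ / T.card := by positivity
    have hξ0 : 0 ≤ ξ k := by positivity
    have hξ1 : ξ k ≤ 1 := div_le_one_of_le₀ (by gcongr) (by positivity)
    have hξx : ξ k * x ^ 2 = (‖coeffOn T r k‖ / T.card) ^ 2 := by
      rcases hx0.eq_or_lt with h | h
      · rw [← hx, ← h] at hζ
        rw [le_antisymm hζ hζ0, ← h]; simp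
      · simp only [hξ]; field_simp
    have h1 := cosh_le_of_sq_eq (x := a * x) (v := a * ((1 - η) * x))
      (w := a * rmsOn T (kaczmarzStep T η k r)) hξ0 hξ1 (by
        rw [mul_pow, rmsOn_kaczmarzStep_sq hT, ← hξx, ← hx]; ring)
    have h2 : Real.cosh (a * ((1 - η) * x)) - 1 ≤ D / 2 := by
      have := cosh_max_sub_le (u := a * x) hac
      rwa [hη, one_sub_adaptiveRelax_mul_rmsOn T hc.le, mul_max_of_nonneg _ _ ha, mul_sub,
        mul_zero]
    have h3 := mul_le_mul_of_nonneg_left h2 hξ0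
    nlinarith
  calc _ ≤ (N : ℝ)⁻¹ * ∑ k, (D - D / 2 * ξ k) :=
        mul_le_mul_of_nonneg_left (Finset.sum_le_sum fun k _ => hk k) (by positivity)
    _ = D - D / 2 * ((N : ℝ)⁻¹ * ∑ k, ξ k) := by
      rw [Finset.sum_sub_distrib, ← Finset.mul_sum]
      simp
      field_simp
    _ ≤ _ := by
      rcases hx0.eq_or_lt with h | h
      · have : D = 0 := by rw [hD, ← h]; simp
        rw [this]; simp
      · simp only [hξ, ← Finset.sum_div]
        rw [← mul_div_assoc, avg_norm_coeffOn_div_sq hT, ← hx]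
        apply le_of_eq
        field_simp

lemma exp_sub_sq_le {u : ℝ} (hu : |u| ≤ 1 / 2) : Real.exp (u - u ^ 2) ≤ 1 + u := by
  obtain ⟨h1, h2⟩ := abs_le.1 hu
  rw [← neg_sub, Real.exp_neg]
  rcases le_total 0 u with h0 | h0
  · have h3 := Real.add_one_le_exp (u ^ 2 - u)
    rw [inv_le_iff_one_le_mul₀ (Real.exp_pos _)]
    nlinarith [pow_nonneg h0 3]
  · have h3 := Real.quadratic_le_exp_of_nonneg (x := u ^ 2 - u) (by nlinarith)
    rw [inv_le_iff_one_le_mul₀ (Real.exp_pos _)]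
    refine le_trans ?_ (mul_le_mul_of_nonneg_left h3 (by linarith))
    have h4 : 0 ≤ 1 + u - u ^ 2 + u ^ 3 := by
      have : -(1 / 8) ≤ u ^ 3 := by nlinarith
      nlinarith
    nlinarith [mul_nonneg (sq_nonneg u) h4]

/-- The step decreases the root mean square of the residual by at least the square of its relative
length, divided by `2c`. -/
lemma rmsOn_kaczmarzStep_le {T : Finset (ZMod N)} (hT : T.Nonempty) {c : ℝ} (hc : 0 < c)
    (k : ZMod N) (r : ZMod N → ℂ) :
    rmsOn T (kaczmarzStep T (adaptiveRelax T c r) k r)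
      ≤ rmsOn T r - (adaptiveRelax T c r * (‖coeffOn T r k‖ / T.card)) ^ 2 / (2 * c) := by
  have hsq := rmsOn_kaczmarzStep_sq hT (adaptiveRelax T c r) k r
  have hζ := norm_coeffOn_div_le hT r k
  have hζ0 : 0 ≤ ‖coeffOn T r k‖ / T.card := by positivity
  have h0 := adaptiveRelax_nonneg T hc.le r
  have h1 := adaptiveRelax_le_one T c r
  have hc' := adaptiveRelax_mul_rmsOn_le T hc.le r
  have hx0 := rmsOn_nonneg T r
  generalize adaptiveRelax T c r = η at *
  generalize ‖coeffOn T r k‖ / (T.card : ℝ) = ζ at *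
  generalize rmsOn T r = x at *
  have hηζ : η * ζ ≤ c := (mul_le_mul_of_nonneg_left hζ h0).trans hc'
  have hηζx : η * ζ ≤ x := (mul_le_of_le_one_left hζ0 h1).trans hζ
  have hP : (η * ζ) ^ 2 ≤ c * x := by
    rw [sq]; exact mul_le_mul hηζ hηζx (by positivity) hc.le
  have hpos : 0 ≤ x - (η * ζ) ^ 2 / (2 * c) := by
    rw [sub_nonneg, div_le_iff₀ (by positivity)]; nlinarith
  refine le_of_sq_le_sq ?_ hpos
  rw [hsq]
  have h3 : x * (η * ζ) ^ 2 / c ≤ η * ζ ^ 2 := by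
    rw [div_le_iff₀ hc]
    have := mul_le_mul_of_nonneg_right hc' (show 0 ≤ η * ζ ^ 2 by positivity)
    nlinarith
  have h4 : (x - (η * ζ) ^ 2 / (2 * c)) ^ 2
      = x ^ 2 - x * (η * ζ) ^ 2 / c + ((η * ζ) ^ 2 / (2 * c)) ^ 2 := by field_simp; ring
  rw [h4]
  have h5 : 0 ≤ (η * (1 - η)) * ζ ^ 2 := by
    have : 0 ≤ 1 - η := by linarith
    positivity
  nlinarith [sq_nonneg ((η * ζ) ^ 2 / (2 * c))]

/-- Off `T` the iteration is a martingale, whose quadratic variation is paid for by the decrease of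
the residual on `T`. -/
lemma avg_exp_re_add_rmsOn_le {T : Finset (ZMod N)} (hT : T.Nonempty) {c lam : ℝ} (hc : 0 < c)
    (hlam : 0 ≤ lam) (hlc : lam * c ≤ 1 / 2) {ω : ℂ} (hω : ‖ω‖ = 1) {t : ZMod N} (ht : t ∉ T)
    (r : ZMod N → ℂ) :
    (N : ℝ)⁻¹ * ∑ k, Real.exp (lam * (ω * kaczmarzStep T (adaptiveRelax T c r) k r t).re
        + 2 * c * lam ^ 2 * rmsOn T (kaczmarzStep T (adaptiveRelax T c r) k r))
      ≤ Real.exp (lam * (ω * r t).re + 2 * c * lam ^ 2 * rmsOn T r) := by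
  have hs : (0 : ℝ) < T.card := by exact_mod_cast hT.card_pos
  have hN : (N : ℝ) ≠ 0 := NeZero.ne _
  set η := adaptiveRelax T c r with hη
  set E := Real.exp (lam * (ω * r t).re + 2 * c * lam ^ 2 * rmsOn T r) with hE
  set u : ZMod N → ℝ := fun k =>
    lam * (-(ω * ((η / T.card : ℝ) : ℂ)) * (ZMod.stdAddChar (t * k) * coeffOn T r k)).re with hu
  have hη0 : 0 ≤ η := adaptiveRelax_nonneg T hc.le r
  have hsum : ∑ k, u k = 0 := by
    simp only [hu, ← Finset.mul_sum, ← Complex.re_sum, sum_stdAddChar_mul_coeffOn, if_neg ht]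
    simp
  have hk : ∀ k, Real.exp (lam * (ω * kaczmarzStep T η k r t).re
        + 2 * c * lam ^ 2 * rmsOn T (kaczmarzStep T η k r)) ≤ E * (1 + u k) := by
    intro k
    have hu1 : |u k| ≤ lam * (η * (‖coeffOn T r k‖ / T.card)) := by
      simp only [hu]
      rw [abs_mul, abs_of_nonneg hlam]
      gcongr
      refine (Complex.abs_re_le_norm _).trans (le_of_eq ?_)
      rw [norm_mul, norm_mul, norm_neg, norm_mul, norm_stdAddChar, hω, Complex.norm_real,
        Real.norm_eq_abs, abs_of_nonneg (by positivity)]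
      ring
    have hζ : η * (‖coeffOn T r k‖ / T.card) ≤ c :=
      (mul_le_mul_of_nonneg_left (norm_coeffOn_div_le hT r k) hη0).trans
        (adaptiveRelax_mul_rmsOn_le T hc.le r)
    have hu2 : |u k| ≤ 1 / 2 := hu1.trans ((mul_le_mul_of_nonneg_left hζ hlam).trans hlc)
    have hu3 : u k ^ 2 ≤ (lam * (η * (‖coeffOn T r k‖ / T.card))) ^ 2 := by
      rw [← sq_abs]; gcongr
    have hx := rmsOn_kaczmarzStep_le hT hc k r
    have hx' := mul_le_mul_of_nonneg_left hx (show 0 ≤ 2 * c * lam ^ 2 by positivity)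
    have hx2 : 2 * c * lam ^ 2 * (rmsOn T r - (η * (‖coeffOn T r k‖ / T.card)) ^ 2 / (2 * c))
        = 2 * c * lam ^ 2 * rmsOn T r - (lam * (η * (‖coeffOn T r k‖ / T.card))) ^ 2 := by
      field_simp
    have hre : lam * (ω * kaczmarzStep T η k r t).re = lam * (ω * r t).re + u k := by
      rw [hu, kaczmarzStep, ← mul_add, ← Complex.add_re]
      congr 2; ring
    calc _ ≤ Real.exp ((lam * (ω * r t).re + 2 * c * lam ^ 2 * rmsOn T r) + (u k - u k ^ 2)) := by
          rw [Real.exp_le_exp, hre]; linarith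
      _ = E * Real.exp (u k - u k ^ 2) := by rw [Real.exp_add]
      _ ≤ E * (1 + u k) := by gcongr; exact exp_sub_sq_le hu2
  calc _ ≤ (N : ℝ)⁻¹ * ∑ k, E * (1 + u k) := by gcongr with k; exact hk k
    _ = E := by
      rw [← Finset.mul_sum, Finset.sum_add_distrib, hsum]
      simp
      field_simp

end Supermartingales

/-! ### Approximate dual certificates -/

section Duality

variable {N : ℕ} [NeZero N]

lemma norm_sum_mul_conj_le (T : Finset (ZMod N)) (h r : ZMod N → ℂ) {D : ℝ}
    (hD : ∀ t, t ∉ T → ‖r t‖ ≤ D) :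
    ‖∑ j, h j * (starRingEnd ℂ) (r j)‖
      ≤ √(energyOn T h) * √(energyOn T r) + D * ∑ t ∈ Tᶜ, ‖h t‖ := by
  rw [← Finset.sum_add_sum_compl T]
  refine (norm_add_le _ _).trans (add_le_add ?_ ?_)
  · refine (norm_sum_le _ _).trans ?_
    simp only [norm_mul, RCLike.norm_conj]
    exact Real.sum_mul_le_sqrt_mul_sqrt _ _ _
  · refine (norm_sum_le _ _).trans ?_
    rw [Finset.mul_sum]
    refine Finset.sum_le_sum fun t ht => ?_
    rw [norm_mul, RCLike.norm_conj, mul_comm]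
    gcongr
    exact hD t (Finset.mem_compl.1 ht)

/-- A signal whose Fourier transform vanishes on `l` is controlled on `T` by its values off `T`,
provided that the Kaczmarz iteration with full projections along `l` makes the unit vectors of `T`
small on `T`. -/
lemma sqrt_energyOn_le_of_dft_eq_zero {T : Finset (ZMod N)} (hT : T.Nonempty) {l : List (ZMod N)}
    (hl : ∑ t ∈ T, energyOn T (kaczmarzRun T (fun _ => 1) l (Pi.single t 1)) ≤ 1 / 4)
    {h : ZMod N → ℂ} (hh : ∀ k ∈ l, ZMod.dft h k = 0) :
    √(energyOn T h) ≤ 2 * l.length * ∑ t ∈ Tᶜ, ‖h t‖ := by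
  have hs : (0 : ℝ) < T.card := by exact_mod_cast hT.card_pos
  set ρ := ∑ t ∈ Tᶜ, ‖h t‖ with hρ
  have hρ0 : 0 ≤ ρ := Finset.sum_nonneg fun _ _ => norm_nonneg _
  set w : ZMod N → ZMod N → ℂ := fun t => kaczmarzRun T (fun _ => 1) l (Pi.single t 1) with hw
  have hpt : ∀ t ∈ T, ‖h t‖ ^ 2
      ≤ 2 * energyOn T h * energyOn T (w t) + 2 * (l.length ^ 2 * ρ ^ 2 / T.card) := by
    intro t ht
    have he : energyOn T (Pi.single t 1) ≤ 1 := by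
      rw [energyOn, Finset.sum_eq_single_of_mem t ht fun j _ hj => by simp [Pi.single_eq_of_ne hj]]
      simp
    have h1 : ∑ j, h j * (starRingEnd ℂ) (w t j) = h t := by
      rw [hw, sum_mul_conj_kaczmarzRun T _ h l hh]
      simp [Pi.single_apply, apply_ite (starRingEnd ℂ)]
    have h2 := norm_sum_mul_conj_le T h (w t) (D := l.length / √T.card) fun j hj => by
      have := norm_kaczmarzRun_le hT (φ := fun _ => 1) (fun _ => zero_le_one) (fun _ => le_rfl) l
        (Pi.single t 1) j he
      rwa [Pi.single_eq_of_ne (ne_of_mem_of_not_mem ht hj).symm, norm_zero, zero_add] at this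
    rw [h1, ← hρ] at h2
    calc ‖h t‖ ^ 2 ≤ (√(energyOn T h) * √(energyOn T (w t)) + l.length / √T.card * ρ) ^ 2 := by
          gcongr
      _ ≤ 2 * (√(energyOn T h) * √(energyOn T (w t))) ^ 2
          + 2 * (l.length / √T.card * ρ) ^ 2 := by
          have := add_sq_le (a := √(energyOn T h) * √(energyOn T (w t)))
            (b := l.length / √T.card * ρ)
          linarith
      _ = _ := by
          rw [mul_pow, mul_pow, div_pow, Real.sq_sqrt (energyOn_nonneg _ _),
            Real.sq_sqrt (energyOn_nonneg _ _), Real.sq_sqrt hs.le]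
          ring
  have hsum : energyOn T h ≤ 2 * energyOn T h * (1 / 4) + 2 * (l.length ^ 2 * ρ ^ 2) := by
    calc energyOn T h = ∑ t ∈ T, ‖h t‖ ^ 2 := rfl
      _ ≤ ∑ t ∈ T, (2 * energyOn T h * energyOn T (w t)
          + 2 * (l.length ^ 2 * ρ ^ 2 / T.card)) := Finset.sum_le_sum hpt
      _ = 2 * energyOn T h * ∑ t ∈ T, energyOn T (w t) + 2 * (l.length ^ 2 * ρ ^ 2) := by
        rw [Finset.sum_add_distrib, ← Finset.mul_sum, Finset.sum_const, nsmul_eq_mul]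
        field_simp
      _ ≤ _ := by
        have := energyOn_nonneg T h
        gcongr
  rw [Real.sqrt_le_left (by positivity)]
  nlinarith

/-- An approximate dual certificate forces `f` to be the unique minimizer: `sgn f - r` has its
frequencies in `Om`, is at most `99 / 100` off `T`, and misses `sgn f` on `T` by an amount that
is negligible by the bound `B` for signals with no frequency in `Om`. -/
lemma l1Minimizers_eq_singleton {T : Finset (ZMod N)} {Om : Set (ZMod N)} {f r : ZMod N → ℂ}
    {B : ℝ} (hf : ∀ t, t ∉ T → f t = 0)
    (hB : ∀ h, (∀ k ∈ Om, ZMod.dft h k = 0) → √(energyOn T h) ≤ B * ∑ t ∈ Tᶜ, ‖h t‖)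
    (hr : ∀ h, (∀ k ∈ Om, ZMod.dft h k = 0) → ∑ j, h j * (starRingEnd ℂ) (r j)
      = ∑ j, h j * (starRingEnd ℂ) (f j / ‖f j‖))
    (hrT : √(energyOn T r) * B ≤ 1 / 200) (hrc : ∀ t, t ∉ T → ‖r t‖ ≤ 99 / 100) :
    l1Minimizers Om f = {f} := by
  have key : ∀ g ∈ feasibleSet Om f,
      l1Norm f + (1 / 200) * ∑ t ∈ Tᶜ, ‖(g - f) t‖ ≤ l1Norm g := by
    intro g hg
    have hh : ∀ k ∈ Om, ZMod.dft (g - f) k = 0 := fun k hk => by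
      rw [map_sub, Pi.sub_apply, hg k hk, sub_self]
    have h1 := norm_sum_mul_conj_le T (g - f) r hrc
    have h2 := hB _ hh
    rw [hr _ hh] at h1
    set ρ := ∑ t ∈ Tᶜ, ‖(g - f) t‖ with hρ
    have hρ0 : 0 ≤ ρ := Finset.sum_nonneg fun _ _ => norm_nonneg _
    have h3 : √(energyOn T (g - f)) * √(energyOn T r) ≤ 1 / 200 * ρ := by
      calc _ ≤ B * ρ * √(energyOn T r) := by gcongr
        _ = √(energyOn T r) * B * ρ := by ring
        _ ≤ _ := by gcongr
    have hpt : ∀ t, ‖f t‖ + ((g - f) t * (starRingEnd ℂ) (f t / ‖f t‖)).re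
        + (if t ∈ Tᶜ then ‖(g - f) t‖ else 0) ≤ ‖g t‖ := by
      intro t
      by_cases h0 : f t = 0
      · split_ifs <;> simp [h0]
      · rw [if_neg (by simpa using fun ht => h0 (hf t ht)), add_zero]
        have hn : (‖f t‖ : ℂ) ≠ 0 := by simpa using h0
        have e1 : f t * (starRingEnd ℂ) (f t / ‖f t‖) = ‖f t‖ := by
          rw [map_div₀, Complex.conj_ofReal, ← mul_div_assoc, Complex.mul_conj']
          field_simp
        have e2 : ‖f t‖ + ((g - f) t * (starRingEnd ℂ) (f t / ‖f t‖)).re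
            = (g t * (starRingEnd ℂ) (f t / ‖f t‖)).re := by
          rw [Pi.sub_apply, sub_mul, e1]; simp
        rw [e2]
        refine (Complex.re_le_norm _).trans ?_
        rw [norm_mul, RCLike.norm_conj, norm_div, Complex.norm_real, norm_norm, div_self, mul_one]
        simpa using h0
    have hsum := Finset.sum_le_sum fun t (_ : t ∈ Finset.univ) => hpt t
    rw [Finset.sum_add_distrib, Finset.sum_add_distrib, ← Complex.re_sum, Finset.sum_ite_mem,
      Finset.univ_inter, ← hρ] at hsum
    have h4 := (abs_le.1 ((Complex.abs_re_le_norm _).trans h1)).1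
    unfold l1Norm
    linarith
  have hff : f ∈ feasibleSet Om f := fun _ _ => rfl
  ext g
  simp only [l1Minimizers, Set.mem_ofPred_eq, Set.mem_singleton_iff]
  constructor
  · rintro ⟨hg, hmin⟩
    have h1 := key g hg
    have h2 := hmin f hff
    have hρ0 : 0 ≤ ∑ t ∈ Tᶜ, ‖(g - f) t‖ := Finset.sum_nonneg fun _ _ => norm_nonneg _
    have hρ : ∑ t ∈ Tᶜ, ‖(g - f) t‖ = 0 := by linarith
    have h3 := hB (g - f) fun k hk => by
      rw [map_sub, Pi.sub_apply, hg k hk, sub_self]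
    rw [hρ, mul_zero, Real.sqrt_le_left le_rfl] at h3
    have h4 : energyOn T (g - f) = 0 := le_antisymm (by simpa using h3) (energyOn_nonneg _ _)
    rw [Finset.sum_eq_zero_iff_of_nonneg fun _ _ => norm_nonneg _] at hρ
    rw [energyOn, Finset.sum_eq_zero_iff_of_nonneg fun _ _ => by positivity] at h4
    ext t
    rw [← sub_eq_zero, ← Pi.sub_apply, ← norm_eq_zero]
    by_cases ht : t ∈ T
    · simpa using h4 t ht
    · exact hρ t (Finset.mem_compl.2 ht)
  · rintro rfl
    refine ⟨hff, fun h hh => ?_⟩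
    have := key h hh
    have hρ0 : 0 ≤ ∑ t ∈ Tᶜ, ‖(h - g) t‖ := Finset.sum_nonneg fun _ _ => norm_nonneg _
    linarith

lemma l1Minimizers_zero (Om : Set (ZMod N)) :
    l1Minimizers Om (0 : ZMod N → ℂ) = {0} := by
  have h0 : l1Norm (0 : ZMod N → ℂ) = 0 := by simp [l1Norm]
  ext g
  simp only [l1Minimizers, Set.mem_ofPred_eq, Set.mem_singleton_iff]
  constructor
  · rintro ⟨-, hmin⟩
    have h1 := hmin 0 fun _ _ => rfl
    rw [h0, l1Norm] at h1
    have h2 := le_antisymm h1 (Finset.sum_nonneg fun _ _ => norm_nonneg _)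
    rw [Finset.sum_eq_zero_iff_of_nonneg fun _ _ => norm_nonneg _] at h2
    ext t
    simpa using h2 t (Finset.mem_univ t)
  · rintro rfl
    refine ⟨fun _ _ => rfl, fun h _ => ?_⟩
    rw [h0]
    exact Finset.sum_nonneg fun _ _ => norm_nonneg _

end Duality

/-! ### The Bernoulli set as a set of Poisson many uniform draws -/

section Law

variable {N : ℕ} [NeZero N] {S : Type u} [MeasurableSpace S] {P : Measure S}
  {τ : ℝ} {I : ZMod N → S → ℕ}

lemma measurableSet_randomFreq_eq (hI : IsBernoulliFamily P τ I) (A : Finset (ZMod N)) :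
    MeasurableSet {s | randomFreq I s = A} := by
  have : {s | randomFreq I s = A} = ⋂ k, I k ⁻¹' {n | n = 1 ↔ k ∈ A} := by
    ext s
    simp [randomFreq, Set.ext_iff]
  rw [this]
  exact MeasurableSet.iInter fun k => hI.measurable k trivial

variable [IsProbabilityMeasure P]

lemma measureReal_randomFreq_subset (hI : IsBernoulliFamily P τ I) (B : Finset (ZMod N)) :
    P.real {s | randomFreq I s ⊆ B} = (1 - τ) ^ (N - B.card) := by
  have hset : {s | randomFreq I s ⊆ B} = ⋂ k ∈ Bᶜ, I k ⁻¹' {1}ᶜ := by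
    ext s
    simp only [Set.mem_ofPred_eq, randomFreq, Set.mem_iInter, Finset.mem_compl, Set.mem_preimage,
      Set.mem_compl_iff, Set.mem_singleton_iff, Set.subset_def, Finset.mem_coe]
    exact forall_congr' fun k => not_imp_not.symm
  have hk : ∀ k, P.real (I k ⁻¹' {1}ᶜ) = 1 - τ := fun k => by
    rw [Set.preimage_compl, probReal_compl_eq_one_sub (hI.measurable k (measurableSet_singleton 1)),
      ← hI.prob_one k]
    rfl
  rw [hset, measureReal_def,
    hI.indep.measure_inter_preimage_eq_mul _ fun k _ => (measurableSet_singleton 1).compl,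
    ENNReal.toReal_prod]
  simp only [← measureReal_def, hk, Finset.prod_const, Finset.card_compl, ZMod.card]

lemma sum_measureReal_randomFreq_eq (hI : IsBernoulliFamily P τ I) (B : Finset (ZMod N)) :
    ∑ A ∈ B.powerset, P.real {s | randomFreq I s = A} = (1 - τ) ^ (N - B.card) := by
  rw [← measureReal_randomFreq_subset hI, ← measureReal_biUnion_finset]
  · congr 1
    ext s
    simp only [Finset.mem_powerset, Set.mem_iUnion, Set.mem_ofPred_eq, exists_prop]
    constructor
    · rintro ⟨A, hA, h⟩
      rw [h]; exact_mod_cast hA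
    · intro h
      refine ⟨(randomFreq I s).toFinite.toFinset, ?_, by simp⟩
      rw [← Finset.coe_subset]; simpa using h
  · intro A _ A' _ hAA
    refine Set.disjoint_left.2 fun s h h' => hAA ?_
    have h1 : randomFreq I s = A := h
    have h2 : randomFreq I s = A' := h'
    exact_mod_cast h1.symm.trans h2
  · exact fun A _ => measurableSet_randomFreq_eq hI A

lemma hasSum_poisson_mul_pow (lam ρ : ℝ) :
    HasSum (fun m : ℕ => Real.exp (-lam) * lam ^ m / m.factorial * ρ ^ m)
      (Real.exp (-(lam * (1 - ρ)))) := by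
  have h := (NormedSpace.expSeries_div_hasSum_exp (lam * ρ)).mul_left (Real.exp (-lam))
  rw [← Real.exp_eq_exp_ℝ, ← Real.exp_add] at h
  rw [show -(lam * (1 - ρ)) = -lam + lam * ρ by ring]
  exact h.congr_fun fun m => by rw [mul_pow]; ring

/-- A Bernoulli set with parameter `1 - exp (-lam / N)` has the law of the set of `m` uniform draws,
where `m` is Poisson distributed with mean `lam`. Both laws give the same probability to the sets of
subsets of any `B`. -/
lemma hasSum_drawAvg_toFinset (hI : IsBernoulliFamily P τ I) {lam : ℝ}
    (hlam : Real.exp (-(lam / N)) = 1 - τ) (G : Finset (ZMod N) → ℝ) :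
    HasSum (fun m : ℕ => Real.exp (-lam) * lam ^ m / m.factorial *
        drawAvg m fun l : List (ZMod N) => G l.toFinset)
      (∑ A, P.real {s | randomFreq I s = (A : Finset (ZMod N))} * G A) := by
  have hN : (N : ℝ) ≠ 0 := NeZero.ne _
  have hpoint : ∀ B : Finset (ZMod N),
      HasSum (fun m : ℕ => Real.exp (-lam) * lam ^ m / m.factorial *
          drawAvg m fun l : List (ZMod N) => if l.toFinset = B then (1 : ℝ) else 0)
        (P.real {s | randomFreq I s = B}) := by
    intro B
    induction B using Finset.strongInduction with
    | H B ih =>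
      have h1 := hasSum_poisson_mul_pow lam ((B.card : ℝ) / N)
      have h2 := hasSum_sum fun A (hA : A ∈ B.ssubsets) => ih A (Finset.mem_ssubsets.1 hA)
      have hB : B.card ≤ N := by simpa using Finset.card_le_univ B
      have hval : Real.exp (-(lam * (1 - (B.card : ℝ) / N)))
          = P.real {s | randomFreq I s = B}
            + ∑ A ∈ B.ssubsets, P.real {s | randomFreq I s = (A : Finset (ZMod N))} := by
        have h3 := sum_measureReal_randomFreq_eq hI B
        rw [← Finset.add_sum_erase _ _ (Finset.mem_powerset_self B)] at h3
        rw [Finset.ssubsets, h3, ← hlam, ← Real.exp_nat_mul, Nat.cast_sub hB]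
        congr 1
        field_simp
      rw [hval] at h1
      have h3 := h1.sub h2
      rw [add_sub_cancel_right] at h3
      refine h3.congr_fun fun m => ?_
      rw [← drawAvg_toFinset_subset, ← Finset.mul_sum, ← mul_sub, ← drawAvg_sum]
      congr 1
      rw [eq_sub_iff_add_eq, ← drawAvg_add]
      congr 1
      ext l
      simp only [Finset.sum_ite_eq, Finset.mem_ssubsets]
      by_cases h : l.toFinset = B
      · simp [h]
      · simp [h, Finset.ssubset_iff_subset_ne]
  have h := hasSum_sum fun A (_ : A ∈ (Finset.univ : Finset (Finset (ZMod N)))) =>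
    (hpoint A).mul_right (G A)
  refine h.congr_fun fun m => ?_
  simp only [mul_assoc (Real.exp (-lam) * lam ^ m / m.factorial)]
  rw [← Finset.mul_sum]
  congr 1
  simp only [mul_comm _ (G _), ← drawAvg_const_mul, ← drawAvg_sum]
  congr 1
  ext l
  simp

end Law

/-! ### The failure probability -/

section Failure

variable {N : ℕ} [NeZero N]

lemma one_add_sq_div_two_le_cosh {x : ℝ} (hx : 0 ≤ x) : 1 + x ^ 2 / 2 ≤ Real.cosh x := by
  have h1 : Real.cosh x = 1 + 2 * Real.sinh (x / 2) ^ 2 := by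
    conv_lhs => rw [show x = 2 * (x / 2) by ring, Real.cosh_two_mul, Real.cosh_sq]
    ring
  have h2 : x / 2 ≤ Real.sinh (x / 2) := Real.self_le_sinh_iff.2 (by positivity)
  have h3 : (x / 2) ^ 2 ≤ Real.sinh (x / 2) ^ 2 := by gcongr
  rw [h1]; linarith

lemma cosh_le_exp {x : ℝ} (hx : 0 ≤ x) : Real.cosh x ≤ Real.exp x := by
  rw [Real.cosh_eq]
  linarith [Real.exp_le_exp.2 (show -x ≤ x by linarith)]

lemma nat_mul_one_sub_pow_le {v : ℝ} (hv0 : 0 < v) (hv1 : v ≤ 1) (m : ℕ) :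
    m * (1 - v) ^ m ≤ 1 / v := by
  have h1 := one_add_mul_le_pow (a := v) (by linarith) m
  have h2 : ((1 + v) * (1 - v)) ^ m ≤ 1 := pow_le_one₀ (by nlinarith) (by nlinarith)
  rw [le_div_iff₀ hv0]
  calc m * (1 - v) ^ m * v ≤ (1 + m * v) * (1 - v) ^ m := by
        nlinarith [pow_nonneg (sub_nonneg.2 hv1) m]
    _ ≤ (1 + v) ^ m * (1 - v) ^ m := by gcongr
    _ ≤ 1 := by rwa [← mul_pow]

/-- A polynomial factor in the number of draws costs a polynomial in `|T|` and a small part of the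
decay rate. -/
lemma sq_mul_one_sub_pow_le {s : ℝ} (hs : 1 ≤ s) (m : ℕ) :
    m ^ 2 * (1 - 1 / (2 * s)) ^ m ≤ (200 * s) ^ 2 * (1 - 49 / (100 * s)) ^ m := by
  set v := 1 / (200 * s) with hv
  have hv0 : 0 < v := by positivity
  have hv1 : v ≤ 1 / 200 := by
    rw [hv]; gcongr; linarith
  have e1 : 1 / (2 * s) = 100 * v := by rw [hv]; field_simp; norm_num
  have e2 : 49 / (100 * s) = 98 * v := by rw [hv]; field_simp; norm_num
  have e3 : 200 * s = 1 / v := by rw [hv]; field_simp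
  rw [e1, e2, e3]
  have h1 := nat_mul_one_sub_pow_le hv0 (by linarith) m
  have h2 : 0 ≤ m * (1 - v) ^ m := mul_nonneg (Nat.cast_nonneg _) (pow_nonneg (by linarith) _)
  calc (m : ℝ) ^ 2 * (1 - 100 * v) ^ m
      ≤ m ^ 2 * ((1 - v) ^ 2 * (1 - 98 * v)) ^ m := by
        gcongr
        · linarith
        · nlinarith [sq_nonneg v, mul_nonneg hv0.le (sq_nonneg v)]
    _ = (m * (1 - v) ^ m) ^ 2 * (1 - 98 * v) ^ m := by
        rw [mul_pow, ← pow_mul, mul_comm 2 m, pow_mul]; ring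
    _ ≤ (1 / v) ^ 2 * (1 - 98 * v) ^ m := by
        gcongr
        exact pow_nonneg (by linarith) _

/-- Four directions used to detect a complex number of large modulus. -/
noncomputable def fourDirections : Finset ℂ := {1, -1, Complex.I, -Complex.I}

lemma norm_le_of_forall_fourDirections {z : ℂ}
    (h : ∀ ω ∈ fourDirections, (ω * z).re ≤ 7 / 10) : ‖z‖ ≤ 99 / 100 := by
  simp only [fourDirections, Finset.mem_insert, Finset.mem_singleton, forall_eq_or_imp,
    forall_eq] at h
  obtain ⟨h1, h2, h3, h4⟩ := h
  simp at h1 h2 h3 h4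
  refine abs_le_of_sq_le_sq' ?_ (by norm_num) |>.2
  rw [← Complex.normSq_eq_norm_sq, Complex.normSq_apply]
  nlinarith

/-- The three sources of failure, each dominated by a quantity with a controlled average. -/
lemma one_le_of_l1Minimizers_ne {T : Finset (ZMod N)} (hT : T.Nonempty) {f : ZMod N → ℂ}
    (hf : ∀ t, t ∉ T → f t = 0) {c a lam μ : ℝ} (ha : 1 ≤ a) (hlam : 0 ≤ lam)
    (hμ : 0 ≤ μ) (l : List (ZMod N)) (hl : l1Minimizers (l.toFinset : Set (ZMod N)) f ≠ {f})
    {r : ZMod N → ℂ} (hr : r = kaczmarzRun T (adaptiveRelax T c) l fun t => f t / ‖f t‖) :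
    1 ≤ 4 * ∑ t ∈ T, energyOn T (kaczmarzRun T (fun _ => 1) l (Pi.single t 1))
      + 320000 * T.card * l.length ^ 2 * (Real.cosh (a * rmsOn T r) - 1)
      + ∑ t ∈ Tᶜ, ∑ ω ∈ fourDirections,
          Real.exp (-(7 / 10 * lam)) * Real.exp (lam * (ω * r t).re + μ * rmsOn T r) := by
  have hs : (0 : ℝ) < T.card := by exact_mod_cast hT.card_pos
  have hx0 := rmsOn_nonneg T r
  have p1 : 0 ≤ ∑ t ∈ T, energyOn T (kaczmarzRun T (fun _ => 1) l (Pi.single t 1)) :=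
    Finset.sum_nonneg fun _ _ => energyOn_nonneg _ _
  have p2 : 0 ≤ 320000 * T.card * l.length ^ 2 * (Real.cosh (a * rmsOn T r) - 1) :=
    mul_nonneg (by positivity) (by linarith [Real.one_le_cosh (a * rmsOn T r)])
  have p3 : 0 ≤ ∑ t ∈ Tᶜ, ∑ ω ∈ fourDirections,
      Real.exp (-(7 / 10 * lam)) * Real.exp (lam * (ω * r t).re + μ * rmsOn T r) := by
    positivity
  by_contra hlt
  refine hl (l1Minimizers_eq_singleton (T := T) (r := r) (B := 2 * l.length) hf
    (fun h hh => sqrt_energyOn_le_of_dft_eq_zero hT ?_ fun k hk => hh k (by simpa using hk))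
    (fun h hh => ?_) ?_ fun t ht => norm_le_of_forall_fourDirections fun ω hω => ?_)
  · linarith
  · rw [hr, sum_mul_conj_kaczmarzRun T _ h l fun k hk => hh k (by simpa using hk)]
  -- The inequality `1 / 200 < 2 m ‖r‖` means `160000 m ^ 2 |T| x ^ 2 > 1`, where `x ^ 2` is at most
  -- `2 (cosh (a x) - 1)`.
  · by_contra hbig
    push Not at hbig
    have h1 : (1 / 200) ^ 2 ≤ (√(energyOn T r) * (2 * l.length)) ^ 2 := by gcongr
    rw [mul_pow, Real.sq_sqrt (energyOn_nonneg _ _)] at h1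
    have h2 : energyOn T r = T.card * rmsOn T r ^ 2 := by rw [rmsOn_sq]; field_simp
    have h3 := one_add_sq_div_two_le_cosh (x := a * rmsOn T r) (by positivity)
    have h4 : rmsOn T r ^ 2 ≤ (a * rmsOn T r) ^ 2 := by
      gcongr; exact le_mul_of_one_le_left hx0 ha
    have h5 : 320000 * T.card * l.length ^ 2 * (rmsOn T r ^ 2 / 2)
        ≤ 320000 * T.card * l.length ^ 2 * (Real.cosh (a * rmsOn T r) - 1) := by
      gcongr; linarith
    rw [h2] at h1
    nlinarith
  · by_contra hbig
    push Not at hbig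
    have h1 : 1 ≤ Real.exp (-(7 / 10 * lam)) * Real.exp (lam * (ω * r t).re + μ * rmsOn T r) := by
      rw [← Real.exp_add]
      apply Real.one_le_exp
      nlinarith [mul_nonneg hμ hx0]
    have h2 := Finset.single_le_sum (f := fun ω => Real.exp (-(7 / 10 * lam)) *
      Real.exp (lam * (ω * r t).re + μ * rmsOn T r)) (fun _ _ => by positivity) hω
    have h3 := Finset.single_le_sum (f := fun t => ∑ ω ∈ fourDirections,
      Real.exp (-(7 / 10 * lam)) * Real.exp (lam * (ω * r t).re + μ * rmsOn T r))
      (fun _ _ => by positivity) (Finset.mem_compl.2 ht)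
    linarith

/-- The probability of failure after `m` uniform draws. The step bound `c` is tuned so that the
martingale estimate off `T` fails with probability `exp (-L)` in each direction. -/
lemma drawAvg_l1Minimizers_ne_le {T : Finset (ZMod N)} (hT : T.Nonempty) {f : ZMod N → ℂ}
    (hf : ∀ t, t ∉ T → f t = 0) {L : ℝ} (hL : 1 / 2 ≤ L) (m : ℕ) (G : Finset (ZMod N) → ℝ)
    (hG0 : ∀ A : Finset (ZMod N), l1Minimizers (A : Set (ZMod N)) f = {f} → G A = 0)
    (hG1 : ∀ A, G A ≤ 1) :
    drawAvg m (fun l : List (ZMod N) => G l.toFinset)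
      ≤ 4 * T.card * (1 - 1 / (T.card : ℝ)) ^ m
        + 320000 * T.card * (200 * T.card) ^ 2 * Real.exp (80 / 7 * L)
          * (1 - 49 / (100 * (T.card : ℝ))) ^ m
        + 4 * N * Real.exp (-L) := by
  have hs : (1 : ℝ) ≤ T.card := by exact_mod_cast hT.card_pos
  have hs0 : (0 : ℝ) < T.card := by linarith
  -- The martingale bound `-(7/10) lam + 2 c lam ^ 2` is smallest at `lam = 7 / (40 c)`, where it is
  -- `-49 / (800 c) = -L`. The rate `a` is such that `a c = 7 / 10`, where
  -- `exp (-7 / 10) ≤ 1 / 2`.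
  set c : ℝ := 49 / (800 * L) with hc
  set a : ℝ := 80 / 7 * L with ha
  set lam : ℝ := 20 / 7 * L with hlam
  have hL0 : 0 < L := by linarith
  have hc0 : 0 < c := by positivity
  have hac : 7 / 10 ≤ a * c := by rw [ha, hc]; apply le_of_eq; field_simp; norm_num
  have hlc : lam * c ≤ 1 / 2 := by
    have : lam * c = 7 / 40 := by rw [hlam, hc]; field_simp; norm_num
    rw [this]; norm_num
  set r₀ : ZMod N → ℂ := fun t => f t / ‖f t‖ with hr₀
  have hr₀x : rmsOn T r₀ ≤ 1 := by
    rw [rmsOn, ← Real.sqrt_one]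
    refine Real.sqrt_le_sqrt ?_
    rw [div_le_one hs0, energyOn]
    calc ∑ j ∈ T, ‖r₀ j‖ ^ 2 ≤ ∑ j ∈ T, 1 := by
          refine Finset.sum_le_sum fun j _ => pow_le_one₀ (norm_nonneg _) ?_
          rw [hr₀, norm_div, Complex.norm_real, norm_norm]
          exact div_self_le_one _
      _ = T.card := by simp
  have hx0 := rmsOn_nonneg T r₀
  calc drawAvg m (fun l : List (ZMod N) => G l.toFinset)
      ≤ drawAvg m (fun l : List (ZMod N) =>
        4 * ∑ t ∈ T, energyOn T (kaczmarzRun T (fun _ => 1) l (Pi.single t 1))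
        + 320000 * T.card * m ^ 2 *
          (Real.cosh (a * rmsOn T (kaczmarzRun T (adaptiveRelax T c) l r₀)) - 1)
        + ∑ t ∈ Tᶜ, ∑ ω ∈ fourDirections, Real.exp (-(7 / 10 * lam)) *
          Real.exp (lam * (ω * kaczmarzRun T (adaptiveRelax T c) l r₀ t).re
            + 2 * c * lam ^ 2 * rmsOn T (kaczmarzRun T (adaptiveRelax T c) l r₀))) := by
        refine drawAvg_mono fun l hl => ?_
        by_cases hmin : l1Minimizers (l.toFinset : Set (ZMod N)) f = {f}
        · rw [hG0 _ hmin]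
          have p1 : 0 ≤ ∑ t ∈ T, energyOn T (kaczmarzRun T (fun _ => 1) l (Pi.single t 1)) :=
            Finset.sum_nonneg fun _ _ => energyOn_nonneg _ _
          have p2 := sub_nonneg.2 (Real.one_le_cosh
            (a * rmsOn T (kaczmarzRun T (adaptiveRelax T c) l r₀)))
          positivity
        · refine (hG1 _).trans ?_
          rw [← hl]
          exact one_le_of_l1Minimizers_ne hT hf (by rw [ha]; linarith) (by positivity)
            (by positivity) l hmin rfl
    _ = 4 * ∑ t ∈ T, drawAvg m (fun l : List (ZMod N) =>
          energyOn T (kaczmarzRun T (fun _ => 1) l (Pi.single t 1)))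
        + 320000 * T.card * m ^ 2 * drawAvg m (fun l : List (ZMod N) =>
          (Real.cosh (a * rmsOn T (kaczmarzRun T (adaptiveRelax T c) l r₀)) - 1))
        + ∑ t ∈ Tᶜ, ∑ ω ∈ fourDirections, Real.exp (-(7 / 10 * lam)) *
          drawAvg m (fun l : List (ZMod N) =>
            Real.exp (lam * (ω * kaczmarzRun T (adaptiveRelax T c) l r₀ t).re
            + 2 * c * lam ^ 2 * rmsOn T (kaczmarzRun T (adaptiveRelax T c) l r₀))) := by
        simp only [drawAvg_add, drawAvg_const_mul, drawAvg_sum]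
    _ ≤ 4 * ∑ t ∈ T, (1 - 1 / (T.card : ℝ)) ^ m
        + 320000 * T.card * m ^ 2 * ((1 - 1 / (2 * (T.card : ℝ))) ^ m * Real.exp a)
        + ∑ t ∈ Tᶜ, ∑ ω ∈ fourDirections, Real.exp (-L) := by
        refine add_le_add (add_le_add ?_ ?_) ?_
        · gcongr with t ht
          refine (drawAvg_energyOn_le hT m _).trans (mul_le_of_le_one_right ?_ ?_)
          · refine pow_nonneg ?_ _
            rw [sub_nonneg, div_le_one hs0]; exact hs
          · rw [energyOn, Finset.sum_eq_single_of_mem t ht fun j _ hj => by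
              simp [Pi.single_eq_of_ne hj]]
            simp
        · gcongr
          have hρ : 0 ≤ 1 - 1 / (2 * (T.card : ℝ)) := by
            rw [sub_nonneg, div_le_one (by positivity)]; linarith
          refine (drawAvg_kaczmarzRun_le T _ (fun r => Real.cosh (a * rmsOn T r) - 1) hρ
            (avg_cosh_rmsOn_le hT hc0 (by positivity) hac) m r₀).trans ?_
          refine mul_le_mul_of_nonneg_left ?_ (pow_nonneg hρ _)
          have h1 := cosh_le_exp (x := a * rmsOn T r₀) (by positivity)
          have h2 : Real.exp (a * rmsOn T r₀) ≤ Real.exp a :=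
            Real.exp_le_exp.2 (mul_le_of_le_one_right (by positivity) hr₀x)
          linarith
        · refine Finset.sum_le_sum fun t ht => Finset.sum_le_sum fun ω hω => ?_
          have ht' := Finset.mem_compl.1 ht
          have hω1 : ‖ω‖ = 1 := by
            simp only [fourDirections, Finset.mem_insert, Finset.mem_singleton] at hω
            rcases hω with rfl | rfl | rfl | rfl <;> simp
          have h1 := drawAvg_kaczmarzRun_le T (adaptiveRelax T c)
            (fun r => Real.exp (lam * (ω * r t).re + 2 * c * lam ^ 2 * rmsOn T r)) zero_le_one
            (fun r => by
              rw [one_mul]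
              exact avg_exp_re_add_rmsOn_le hT hc0 (by positivity) hlc hω1 ht' r) m r₀
          have h2 : r₀ t = 0 := by simp [hr₀, hf t ht']
          rw [one_pow, one_mul, h2] at h1
          refine (mul_le_mul_of_nonneg_left h1 (Real.exp_pos _).le).trans ?_
          rw [← Real.exp_add, Real.exp_le_exp]
          have h3 : 2 * c * lam ^ 2 = L := by rw [hc, hlam]; field_simp; norm_num
          rw [h3, hlam]
          simp
          nlinarith
    _ ≤ _ := by
        refine add_le_add (add_le_add (le_of_eq ?_) ?_) ?_
        · simp; ring
        · have := sq_mul_one_sub_pow_le hs m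
          calc 320000 * T.card * m ^ 2 * ((1 - 1 / (2 * (T.card : ℝ))) ^ m * Real.exp a)
              = 320000 * T.card * (m ^ 2 * (1 - 1 / (2 * (T.card : ℝ))) ^ m) * Real.exp a := by
                ring
            _ ≤ 320000 * T.card * ((200 * T.card) ^ 2 * (1 - 49 / (100 * (T.card : ℝ))) ^ m)
                * Real.exp a := by gcongr
            _ = _ := by ring
        · rw [Finset.sum_const, Finset.sum_const, nsmul_eq_mul, nsmul_eq_mul, ← mul_assoc,
            mul_comm (4 : ℝ)]
          gcongr
          · simpa using Finset.card_le_univ Tᶜ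
          · exact_mod_cast Finset.card_le_four

end Failure

/-! ### Exact recovery -/

theorem mainTheorem1 (M : ℝ) (hM : 0 < M) (δ : ℝ) (hδ : 0 < δ) :
    ∃ C : ℝ, 0 < C ∧
      ∀ (N : ℕ) [NeZero N], 2 ≤ N → ∀ τ : ℝ, 0 < τ → τ < 1 →
      ∀ (S : Type u) [MeasurableSpace S] (P : Measure S) [IsProbabilityMeasure P]
        (I : ZMod N → S → ℕ), IsBernoulliFamily P τ I →
      ∀ (T : Finset (ZMod N)) (f : ZMod N → ℂ), (∀ t, t ∉ T → f t = 0) →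
        (T.card : ℝ) ≤ (1 - δ) / (29.6 * (M + 1)) * (Real.log N)⁻¹ * (τ * N) →
        1 - C * (N : ℝ) ^ (-M) ≤ P.real {s | l1Minimizers (randomFreq I s) f = {f}} := by
  classical
  -- The three sources of failure contribute `4`, `320000 * 200 ^ 2` and `4`.
  refine ⟨8 + 320000 * 200 ^ 2, by norm_num, ?_⟩
  intro N _ hN τ hτ0 hτ1 S _ P _ I hI T f hf hcard
  have hN0 : (0 : ℝ) < N := by exact_mod_cast (by lia : 0 < N)
  rcases T.eq_empty_or_nonempty with rfl | hT
  · have hf0 : f = 0 := funext fun t => hf t (Finset.notMem_empty t)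
    subst hf0
    simp only [l1Minimizers_zero, Set.ofPred_true, probReal_univ]
    have : 0 ≤ (N : ℝ) ^ (-M) := by positivity
    linarith
  have hs : (1 : ℝ) ≤ T.card := by exact_mod_cast hT.card_pos
  have hs0 : (0 : ℝ) < T.card := by linarith
  have hsN : (T.card : ℝ) ≤ N := by
    exact_mod_cast (by simpa using Finset.card_le_univ T : T.card ≤ N)
  have hlog : Real.log 2 ≤ Real.log N := Real.log_le_log (by norm_num) (by exact_mod_cast hN)
  have hlog2 := Real.log_two_gt_d9
  set L := (M + 1) * Real.log N with hL
  have hL1 : 1 / 2 ≤ L := by nlinarith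
  have hNL : N * Real.exp (-L) = (N : ℝ) ^ (-M) := by
    rw [Real.rpow_def_of_pos hN0]
    nth_rewrite 1 [← Real.exp_log hN0]
    rw [← Real.exp_add, hL]
    congr 1; ring
  -- The mean of the number of uniform draws whose set has the law of the Bernoulli set.
  set lam := -(N * Real.log (1 - τ)) with hlam
  have hlamτ : τ * N ≤ lam := by
    have := Real.log_le_sub_one_of_pos (show 0 < 1 - τ by linarith)
    nlinarith
  have hlamexp : Real.exp (-(lam / N)) = 1 - τ := by
    rw [hlam, neg_div, neg_neg, mul_div_cancel_left₀ _ hN0.ne', Real.exp_log (by linarith)]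
  have hratio : 29.6 * L ≤ lam / T.card := by
    rw [le_div_iff₀ hs0]
    have h1 : (1 - δ) / (29.6 * (M + 1)) * (Real.log N)⁻¹ * (τ * N)
        = (1 - δ) * (τ * N) / (29.6 * L) := by
      rw [hL]; field_simp
    rw [h1, le_div_iff₀ (by linarith)] at hcard
    have h2 : (1 - δ) * (τ * N) ≤ τ * N := by
      have : 0 < τ * N := by positivity
      nlinarith
    linarith
  set G : Finset (ZMod N) → ℝ :=
    fun A => if l1Minimizers (A : Set (ZMod N)) f = {f} then 0 else 1 with hG
  have hfail : P.real {s | l1Minimizers (randomFreq I s) f = {f}}ᶜ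
      ≤ ∑ A, P.real {s | randomFreq I s = (A : Finset (ZMod N))} * G A := by
    calc _ ≤ P.real (⋃ A ∈ (Finset.univ.filter fun A : Finset (ZMod N) =>
            l1Minimizers (A : Set (ZMod N)) f ≠ {f}), {s | randomFreq I s = A}) := by
          refine measureReal_mono (fun s hs => ?_) (measure_ne_top _ _)
          simp only [Set.mem_iUnion, Finset.mem_filter, Finset.mem_univ, true_and, exists_prop]
          refine ⟨(randomFreq I s).toFinite.toFinset, ?_, ?_⟩
          · simpa using hs
          · simp
      _ ≤ ∑ A ∈ (Finset.univ.filter fun A : Finset (ZMod N) =>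
            l1Minimizers (A : Set (ZMod N)) f ≠ {f}), P.real {s | randomFreq I s = A} :=
          measureReal_biUnion_finset_le _ _
      _ = _ := by
          rw [Finset.sum_filter]
          refine Finset.sum_congr rfl fun A _ => ?_
          by_cases h : l1Minimizers (A : Set (ZMod N)) f = {f} <;> simp [hG, h]
  have hbound : ∑ A, P.real {s | randomFreq I s = (A : Finset (ZMod N))} * G A
      ≤ 4 * T.card * Real.exp (-(lam / T.card))
        + 320000 * T.card * (200 * T.card) ^ 2 * Real.exp (80 / 7 * L)
          * Real.exp (-(49 / 100 * (lam / T.card)))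
        + 4 * N * Real.exp (-L) := by
    have h1 := (hasSum_poisson_mul_pow lam (1 - 1 / (T.card : ℝ))).mul_left (4 * (T.card : ℝ))
    have h2 := (hasSum_poisson_mul_pow lam (1 - 49 / (100 * (T.card : ℝ)))).mul_left
      (320000 * T.card * (200 * T.card) ^ 2 * Real.exp (80 / 7 * L))
    have h3 := (hasSum_poisson_mul_pow lam 1).mul_left (4 * N * Real.exp (-L))
    have h4 := (h1.add h2).add h3
    have e1 : lam * (1 - (1 - 1 / (T.card : ℝ))) = lam / T.card := by ring
    have e2 : lam * (1 - (1 - 49 / (100 * (T.card : ℝ)))) = 49 / 100 * (lam / T.card) := by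
      field_simp; ring
    rw [e1, e2, sub_self, mul_zero, neg_zero, Real.exp_zero, mul_one] at h4
    refine hasSum_le (fun m => ?_) (hasSum_drawAvg_toFinset hI hlamexp G) h4
    have hlam0 : 0 ≤ lam := le_trans (by positivity) hlamτ
    have h5 := drawAvg_l1Minimizers_ne_le hT hf hL1 m G (fun A hA => by simp [hG, hA])
      (fun A => by simp only [hG]; split_ifs <;> norm_num)
    refine (mul_le_mul_of_nonneg_left h5 (by positivity)).trans (le_of_eq ?_)
    rw [one_pow]; ring
  have hsL : T.card * Real.exp (-L) ≤ (N : ℝ) ^ (-M) := by rw [← hNL]; gcongr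
  have hp0 : 0 ≤ (N : ℝ) ^ (-M) := by positivity
  have hp1 : (N : ℝ) ^ (-M) ≤ 1 :=
    Real.rpow_le_one_of_one_le_of_nonpos (by exact_mod_cast (by lia : 1 ≤ N)) (by linarith)
  have b1 : 4 * T.card * Real.exp (-(lam / T.card)) ≤ 4 * (N : ℝ) ^ (-M) := by
    calc _ ≤ 4 * T.card * Real.exp (-L) := by gcongr; linarith
      _ ≤ _ := by linarith
  have b2 : 320000 * T.card * (200 * T.card) ^ 2 * Real.exp (80 / 7 * L)
      * Real.exp (-(49 / 100 * (lam / T.card))) ≤ 320000 * 200 ^ 2 * (N : ℝ) ^ (-M) := by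
    calc _ = 320000 * 200 ^ 2 * ((T.card : ℝ) ^ 3 *
            Real.exp (80 / 7 * L - 49 / 100 * (lam / T.card))) := by
          rw [sub_eq_add_neg, Real.exp_add]; ring
      -- Here `0.49 * 29.6 ≥ 80 / 7 + 3` leaves a factor `exp (-L)` for each factor `|T|`.
      _ ≤ 320000 * 200 ^ 2 * ((T.card : ℝ) ^ 3 * Real.exp (-L) ^ 3) := by
          rw [← Real.exp_nat_mul]
          gcongr
          push_cast
          linarith
      _ = 320000 * 200 ^ 2 * (T.card * Real.exp (-L)) ^ 3 := by ring
      _ ≤ 320000 * 200 ^ 2 * ((N : ℝ) ^ (-M)) ^ 3 := by gcongr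
      _ ≤ _ := by gcongr; exact pow_le_of_le_one hp0 hp1 (by norm_num)
  have htotal := measureReal_union_le (μ := P) {s | l1Minimizers (randomFreq I s) f = {f}}
    {s | l1Minimizers (randomFreq I s) f = {f}}ᶜ
  rw [Set.union_compl_self, probReal_univ] at htotal
  linarith
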